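/- Let $k$ be a field of characteristic $p>0$, let $i\ge 0$, and let $A_i=k[x_1,\dots,x_i]/(x_1^p,\dots,x_i^p)$, graded by $|x_j|=2p^{j-1}$ for all $j$ (or, alternatively, by $|x_j|=2p^{j}$ for all $j$; the statement holds for both normalizations). For $d\ge 0$ and a $k$-vector space $X$ let $\Gamma^d(X)=(X^{\otimes d})^{\Sigma_d}$. Let $\Gamma^d\mathcal V_{A_i}$ be the graded $k$-linear category whose objects are the finite dimensional $k$-vector spaces, the object given by $V$ being denoted $V\otimes A_i$, with $$\mathrm{Hom}(V\otimes A_i,W\otimes A_i)=\Gamma^d(\mathrm{Hom}_k(V,W)\otimes A_i),$$ graded by the total degree coming from $A_i$; the composition is the restriction of the factorwise composition on $d$-th tensor powers induced by $(f\otimes a,\,g\otimes b)\mapsto (g\circ f)\otimes ab$. Let $\mathcal P_d^{af_i}$ be the graded $k$-linear category of $i$-affine strict polynomial functors of degree $d$: its objects are the $k$-linear degree-preserving functors from $\Gamma^d\mathcal V_{A_i}$ to the graded category of $\mathbb Z$-graded $k$-vector spaces that are bounded below and finite dimensional in each degree, where $\mathrm{Hom}^n$ consists of the linear maps raising degrees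 by $n$; its morphisms of degree $n$ are the natural transformations all of whose components have degree $n$. Let $A_i\text{-}grmod$ be the graded $k$-linear category of $\mathbb Z$-graded $A_i$-modules that are bounded below and finite dimensional in each degree, the morphisms of degree $n$ being the $A_i$-linear maps raising degrees by $n$. (In all these categories a general morphism is a finite sum of homogeneous ones.) Then $\mathcal P_1^{af_i}$ and $A_i\text{-}grmod$ are equivalent as graded $k$-linear categories: there are $k$-linear degree-preserving functors in both directions that are mutually quasi-inverse through natural isomorphisms of degree $0$. -/

import Mathlib

open CategoryTheory TensorProduct

universe u

/-! ## Linear algebra of graded vector spaces -/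

namespace GrLin

section General

variable {k : Type*} [Field k]

theorem isInternal_of_basis {M ι : Type*} [AddCommGroup M] [Module k M]
    (D : ℤ → Submodule k M) (b : Module.Basis ι k M) (δ : ι → ℤ)
    (h1 : ∀ n, ∀ x ∈ D n, ∀ I, b.repr x I ≠ 0 → δ I = n) (h2 : ∀ I, b I ∈ D (δ I)) :
    DirectSum.IsInternal D := by
  classical
  rw [DirectSum.isInternal_submodule_iff_iSupIndep_and_iSup_eq_top]
  constructor
  · rw [iSupIndep_def]
    intro n
    rw [Submodule.disjoint_def]
    intro x hx hx'
    have key : ∀ I, b.repr x I ≠ 0 → δ I ≠ n := by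
      have hle : (⨆ (j : ℤ) (_ : j ≠ n), D j) ≤
          (Finsupp.supported k k {I | δ I ≠ n}).comap b.repr.toLinearMap := by
        refine iSup₂_le fun m hm y hy => ?_
        rw [Submodule.mem_comap, Finsupp.mem_supported]
        intro I hI
        have := h1 m y hy I (by simpa using hI)
        simp [this, hm]
      have h3 := hle hx'
      rw [Submodule.mem_comap, Finsupp.mem_supported] at h3
      intro I hI
      exact h3 (by simpa using hI)
    apply b.repr.injective
    ext I
    by_contra hI
    have hI' : b.repr x I ≠ 0 := by simpa using hI
    exact key I hI' (h1 n x hx I hI')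
  · rw [eq_top_iff, ← b.span_eq, Submodule.span_le]
    rintro _ ⟨I, rfl⟩
    exact Submodule.mem_iSup_of_mem _ (h2 I)

theorem exists_basis {M : Type u} [AddCommGroup M] [Module k M]
    (D : ℤ → Submodule k M) (h : DirectSum.IsInternal D) :
    ∃ (ι : Type u) (b : Module.Basis ι k M) (δ : ι → ℤ),
      (∀ n, ∀ x ∈ D n, ∀ I, b.repr x I ≠ 0 → δ I = n) ∧ ∀ I, b I ∈ D (δ I) := by
  classical
  refine ⟨_, h.collectedBasis fun n => Module.Basis.ofVectorSpace k (D n), Sigma.fst, ?_, ?_⟩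
  · rintro n x hx ⟨m, I⟩ hI
    by_contra hne
    exact hI (h.collectedBasis_repr_of_mem_ne _ (Ne.symm hne) hx)
  · intro I
    exact h.collectedBasis_mem _ I

theorem iSupIndep_of_family {H S : Type*} [AddCommGroup H] [Module k H] {M : S → Type*}
    [∀ s, AddCommGroup (M s)] [∀ s, Module k (M s)] (D : ℤ → Submodule k H)
    (L : ∀ s, H →ₗ[k] M s) (E : ∀ s, ℤ → Submodule k (M s)) (hE : ∀ s, iSupIndep (E s))
    (hD : ∀ s n, ∀ x ∈ D n, L s x ∈ E s n) (hL : ∀ x, (∀ s, L s x = 0) → x = 0) :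
    iSupIndep D := by
  rw [iSupIndep_def]
  intro n
  rw [Submodule.disjoint_def]
  intro x hx hx'
  refine hL x fun s => ?_
  have h := (iSupIndep_def.1 (hE s)) n
  rw [Submodule.disjoint_def] at h
  refine h _ (hD s n x hx) ?_
  have hle : (⨆ (j : ℤ) (_ : j ≠ n), D j) ≤
      (⨆ (j : ℤ) (_ : j ≠ n), E s j).comap (L s) := by
    refine iSup₂_le fun m hm y hy => ?_
    exact Submodule.mem_iSup_of_mem m (Submodule.mem_iSup_of_mem hm (hD s m y hy))
  exact hle hx'

theorem isInternal_comap_iSup {H : Type*} [AddCommGroup H] [Module k H] (D : ℤ → Submodule k H)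
    (h : iSupIndep D) :
    DirectSum.IsInternal fun n => (D n).comap (⨆ m, D m).subtype := by
  classical
  rw [DirectSum.isInternal_submodule_iff_iSupIndep_and_iSup_eq_top]
  have e : ∀ n, ((D n).comap (⨆ m, D m).subtype).map (⨆ m, D m).subtype = D n := fun n => by
    rw [Submodule.map_comap_subtype, inf_eq_right]
    exact le_iSup D n
  constructor
  · refine iSupIndep_of_family (S := Unit) (M := fun _ => H) _ (fun _ => (⨆ m, D m).subtype)
      (fun _ => D) (fun _ => h) (fun _ n x hx => hx) fun x hx => ?_
    simpa using hx ()
  · apply Submodule.map_injective_of_injective (⨆ m, D m).injective_subtype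
    rw [Submodule.map_iSup]
    simp only [e]
    simp

theorem bilin_mem_iSup {H H' H'' : Type*} [AddCommGroup H] [Module k H] [AddCommGroup H']
    [Module k H'] [AddCommGroup H''] [Module k H''] (B : H →ₗ[k] H' →ₗ[k] H'')
    (D : ℤ → Submodule k H) (D' : ℤ → Submodule k H') (D'' : ℤ → Submodule k H'')
    (hB : ∀ a b, ∀ x ∈ D a, ∀ y ∈ D' b, B x y ∈ D'' (a + b))
    {x : H} (hx : x ∈ ⨆ n, D n) {y : H'} (hy : y ∈ ⨆ n, D' n) : B x y ∈ ⨆ n, D'' n := by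
  refine Submodule.iSup_induction D (motive := fun x => B x y ∈ ⨆ n, D'' n) hx ?_ (by simp) ?_
  · intro a x hx
    refine Submodule.iSup_induction D' (motive := fun y => B x y ∈ ⨆ n, D'' n) hy ?_ (by simp) ?_
    · intro b y hy
      exact Submodule.mem_iSup_of_mem _ (hB a b x hx y hy)
    · intro y z h h'
      rw [map_add]
      exact add_mem h h'
  · intro y z h h'
    rw [map_add, LinearMap.add_apply]
    exact add_mem h h'

end General

end GrLin

/-! ## Graded linear categories -/

/-- A `k`-linear category is graded when every space of morphisms is the direct sum of its
subspaces of morphisms of degree `n`, `n ∈ ℤ`, identities have degree `0` and degrees add up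
under composition. -/
class GradedLinear (k : Type*) [Field k] (C : Type*) [Category C] [Preadditive C]
    [Linear k C] where
  deg (X Y : C) : ℤ → Submodule k (X ⟶ Y)
  isInternal (X Y : C) : DirectSum.IsInternal (deg X Y)
  id_mem (X : C) : 𝟙 X ∈ deg X X 0
  comp_mem {X Y Z : C} {a b : ℤ} {f : X ⟶ Y} {g : Y ⟶ Z} :
    f ∈ deg X Y a → g ∈ deg Y Z b → f ≫ g ∈ deg X Z (a + b)

section GradedFunctors

variable (k : Type*) [Field k] {C D : Type*} [Category C] [Preadditive C] [Linear k C]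
  [GradedLinear k C] [Category D] [Preadditive D] [Linear k D] [GradedLinear k D]

/-- A functor between graded `k`-linear categories is graded when it is `k`-linear on morphisms
and preserves degrees. -/
structure IsGradedFunctor (F : C ⥤ D) : Prop where
  map_add {X Y : C} (f g : X ⟶ Y) : F.map (f + g) = F.map f + F.map g
  map_smul {X Y : C} (r : k) (f : X ⟶ Y) : F.map (r • f) = r • F.map f
  map_mem {X Y : C} {n : ℤ} {f : X ⟶ Y} :
    f ∈ GradedLinear.deg (k := k) X Y n → F.map f ∈ GradedLinear.deg (k := k) (F.obj X) (F.obj Y) n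

variable (C D) in
/-- An equivalence of graded `k`-linear categories: two mutually quasi-inverse graded functors,
with unit and counit of degree `0`. In particular it restricts to a `k`-linear equivalence of the
subcategories of morphisms of degree `0`. -/
structure GradedEquivalence where
  equivalence : C ≌ D
  functor_graded : IsGradedFunctor k equivalence.functor
  inverse_graded : IsGradedFunctor k equivalence.inverse
  unit_mem (X : C) : equivalence.unitIso.hom.app X ∈ GradedLinear.deg (k := k) _ _ 0
  counit_mem (Y : D) : equivalence.counitIso.hom.app Y ∈ GradedLinear.deg (k := k) _ _ 0

variable (C D) in
/-- Graded `k`-linear functors from `C` to `D`. -/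
structure GradedFunctor where
  functor : C ⥤ D
  isGraded : IsGradedFunctor k functor

namespace GradedFunctor

variable {k}

/-- Natural transformations all of whose components have degree `n`. (There is no sign in the
naturality condition; the functor categories below have a source concentrated in even degrees.) -/
def transDeg (F G : GradedFunctor k C D) (n : ℤ) : Submodule k (F.functor ⟶ G.functor) where
  carrier := {η | ∀ X, η.app X ∈ GradedLinear.deg (k := k) _ _ n}
  add_mem' h h' X := by
    rw [NatTrans.app_add]
    exact add_mem (h X) (h' X)
  zero_mem' X := by
    rw [NatTrans.app_zero]
    exact zero_mem _
  smul_mem' r η h X := by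
    rw [NatTrans.app_smul]
    exact Submodule.smul_mem _ r (h X)

theorem transDeg_indep (F G : GradedFunctor k C D) : iSupIndep (transDeg F G) := by
  refine GrLin.iSupIndep_of_family (k := k) (S := C)
    (M := fun X => F.functor.obj X ⟶ G.functor.obj X) _
    (fun X => { toFun := fun η => η.app X, map_add' := fun _ _ => rfl, map_smul' := fun _ _ => rfl })
    (fun X => GradedLinear.deg (k := k) _ _)
    (fun X => (GradedLinear.isInternal (k := k) _ _).submodule_iSupIndep) (fun X n η h => h X) ?_
  intro η h
  ext X
  exact h X

theorem comp_mem_transDeg {F G H : GradedFunctor k C D} {a b : ℤ} {f : F.functor ⟶ G.functor}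
    {g : G.functor ⟶ H.functor} (h : f ∈ transDeg F G a) (h' : g ∈ transDeg G H b) :
    f ≫ g ∈ transDeg F H (a + b) :=
  fun X => GradedLinear.comp_mem (h X) (h' X)

/-- Morphisms of graded functors are finite sums of homogeneous natural transformations. -/
instance : Category (GradedFunctor k C D) where
  Hom F G := ↥(⨆ n, transDeg F G n)
  id F := ⟨𝟙 F.functor, Submodule.mem_iSup_of_mem 0 fun _ => GradedLinear.id_mem _⟩
  comp {F G H} f g := ⟨f.1 ≫ g.1,
    GrLin.bilin_mem_iSup (Linear.comp F.functor G.functor H.functor : _ →ₗ[k] _ →ₗ[k] _)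
      (transDeg F G) (transDeg G H) (transDeg F H)
      (fun _ _ _ h _ h' => comp_mem_transDeg h h') f.2 g.2⟩
  id_comp _ := Subtype.ext (Category.id_comp _)
  comp_id _ := Subtype.ext (Category.comp_id _)
  assoc _ _ _ := Subtype.ext (Category.assoc _ _ _)

instance : Preadditive (GradedFunctor k C D) where
  homGroup F G := inferInstanceAs (AddCommGroup ↥(⨆ n, transDeg F G n))
  add_comp _ _ _ _ _ _ := Subtype.ext (Preadditive.add_comp _ _ _ _ _ _)
  comp_add _ _ _ _ _ _ := Subtype.ext (Preadditive.comp_add _ _ _ _ _ _)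

instance : Linear k (GradedFunctor k C D) where
  homModule F G := inferInstanceAs (Module k ↥(⨆ n, transDeg F G n))
  smul_comp _ _ _ _ _ _ := Subtype.ext (Linear.smul_comp _ _ _ _ _ _)
  comp_smul _ _ _ _ _ _ := Subtype.ext (Linear.comp_smul _ _ _ _ _ _)

instance : GradedLinear k (GradedFunctor k C D) where
  deg F G n := (transDeg F G n).comap (⨆ m, transDeg F G m).subtype
  isInternal F G := GrLin.isInternal_comap_iSup _ (transDeg_indep F G)
  id_mem _ _ := GradedLinear.id_mem _
  comp_mem h h' := comp_mem_transDeg h h'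

end GradedFunctor

end GradedFunctors

/-! ## Graded vector spaces and graded modules -/

/-- `ℤ`-graded vector spaces that are bounded below and finite dimensional in each degree. -/
structure GrVec (k : Type u) [Field k] where
  carrier : Type u
  [addCommGroup : AddCommGroup carrier]
  [module : Module k carrier]
  gr : ℤ → Submodule k carrier
  isInternal : DirectSum.IsInternal gr
  finite (n : ℤ) : Module.Finite k (gr n)
  boundedBelow : ∃ N : ℤ, ∀ n < N, gr n = ⊥

namespace GrVec

attribute [instance] addCommGroup module

variable {k : Type u} [Field k]

/-- Linear maps of degree `n`. -/
def homDeg (M N : GrVec k) (n : ℤ) : Submodule k (M.carrier →ₗ[k] N.carrier) where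
  carrier := {f | ∀ m, ∀ x ∈ M.gr m, f x ∈ N.gr (m + n)}
  add_mem' h h' m x hx := add_mem (h m x hx) (h' m x hx)
  zero_mem' _ _ _ := zero_mem _
  smul_mem' r _ h m x hx := Submodule.smul_mem _ r (h m x hx)

theorem iSupIndep_shift (N : GrVec k) (m : ℤ) : iSupIndep fun n => N.gr (m + n) :=
  N.isInternal.submodule_iSupIndep.comp (add_right_injective m)

theorem eq_zero_of_homogeneous (M : GrVec k) {P : Type*} [AddCommGroup P] [Module k P]
    (f : M.carrier →ₗ[k] P) (h : ∀ m, ∀ x ∈ M.gr m, f x = 0) : f = 0 := by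
  have : (⨆ m, M.gr m) ≤ LinearMap.ker f := iSup_le fun m x hx => h m x hx
  rw [M.isInternal.submodule_iSup_eq_top, top_le_iff] at this
  exact LinearMap.ker_eq_top.1 this

theorem homDeg_indep (M N : GrVec k) : iSupIndep (homDeg M N) := by
  refine GrLin.iSupIndep_of_family (k := k) (S := Σ m, M.gr m) (M := fun _ => N.carrier) _
    (fun s => LinearMap.applyₗ (s.2 : M.carrier)) (fun s n => N.gr (s.1 + n))
    (fun s => N.iSupIndep_shift s.1) (fun s n f h => h s.1 s.2 s.2.2) ?_
  intro f h
  exact M.eq_zero_of_homogeneous f fun m x hx => h ⟨m, x, hx⟩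

theorem id_mem_homDeg (M : GrVec k) : LinearMap.id ∈ homDeg M M 0 :=
  fun m x hx => by simpa using hx

theorem comp_mem_homDeg {M N P : GrVec k} {a b : ℤ} {f : M.carrier →ₗ[k] N.carrier}
    {g : N.carrier →ₗ[k] P.carrier} (h : f ∈ homDeg M N a) (h' : g ∈ homDeg N P b) :
    g ∘ₗ f ∈ homDeg M P (a + b) :=
  fun m x hx => by simpa [add_assoc] using h' _ _ (h m x hx)

/-- The graded category of graded vector spaces; a morphism is a finite sum of homogeneous linear
maps. -/
instance : Category (GrVec k) where
  Hom M N := ↥(⨆ n, homDeg M N n)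
  id M := ⟨LinearMap.id, Submodule.mem_iSup_of_mem 0 (id_mem_homDeg M)⟩
  comp {M N P} f g := ⟨g.1 ∘ₗ f.1,
    GrLin.bilin_mem_iSup (LinearMap.llcomp k M.carrier N.carrier P.carrier).flip
      (homDeg M N) (homDeg N P) (homDeg M P)
      (fun _ _ _ h _ h' => comp_mem_homDeg h h') f.2 g.2⟩

instance : Preadditive (GrVec k) where
  homGroup M N := inferInstanceAs (AddCommGroup ↥(⨆ n, homDeg M N n))
  add_comp _ _ _ _ _ g := Subtype.ext (LinearMap.comp_add _ _ g.1)
  comp_add _ _ _ f _ _ := Subtype.ext (LinearMap.add_comp f.1 _ _)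

instance : Linear k (GrVec k) where
  homModule M N := inferInstanceAs (Module k ↥(⨆ n, homDeg M N n))
  smul_comp _ _ _ r f g := Subtype.ext (LinearMap.comp_smul g.1 r f.1)
  comp_smul _ _ _ f r g := Subtype.ext (LinearMap.smul_comp r g.1 f.1)

instance : GradedLinear k (GrVec k) where
  deg M N n := (homDeg M N n).comap (⨆ m, homDeg M N m).subtype
  isInternal M N := GrLin.isInternal_comap_iSup _ (homDeg_indep M N)
  id_mem M := id_mem_homDeg M
  comp_mem h h' := comp_mem_homDeg h h'

end GrVec

/-- Graded modules, bounded below and finite dimensional in each degree, over a `k`-algebra `A`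
with grading `𝒜`. -/
structure GrMod (k : Type u) [Field k] {A : Type u} [CommRing A] [Algebra k A]
    (𝒜 : ℤ → Submodule k A) extends GrVec k where
  [moduleA : Module A carrier]
  [tower : IsScalarTower k A carrier]
  smul_mem {a m : ℤ} {r : A} {x : carrier} : r ∈ 𝒜 a → x ∈ gr m → r • x ∈ gr (a + m)

namespace GrMod

attribute [instance] moduleA tower

variable {k : Type u} [Field k] {A : Type u} [CommRing A] [Algebra k A] {𝒜 : ℤ → Submodule k A}

/-- `A`-linear maps of degree `n`. (There is no sign in the linearity condition; below, `A` is
concentrated in even degrees.) -/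
def homDeg (M N : GrMod k 𝒜) (n : ℤ) : Submodule k (M.carrier →ₗ[A] N.carrier) where
  carrier := {f | ∀ m, ∀ x ∈ M.gr m, f x ∈ N.gr (m + n)}
  add_mem' h h' m x hx := add_mem (h m x hx) (h' m x hx)
  zero_mem' _ _ _ := zero_mem _
  smul_mem' r _ h m x hx := Submodule.smul_mem _ r (h m x hx)

theorem homDeg_indep (M N : GrMod k 𝒜) : iSupIndep (homDeg M N) := by
  refine GrLin.iSupIndep_of_family (k := k) (S := Unit)
    (M := fun _ => M.carrier →ₗ[k] N.carrier) _
    (fun _ => { toFun := fun f => f.restrictScalars k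
                map_add' := fun _ _ => rfl
                map_smul' := fun _ _ => rfl })
    (fun _ => GrVec.homDeg M.toGrVec N.toGrVec)
    (fun _ => GrVec.homDeg_indep M.toGrVec N.toGrVec) (fun _ n f h => h) ?_
  intro f h
  ext x
  exact LinearMap.congr_fun (h ()) x

theorem id_mem_homDeg (M : GrMod k 𝒜) : LinearMap.id ∈ homDeg M M 0 :=
  fun m x hx => by simpa using hx

theorem comp_mem_homDeg {M N P : GrMod k 𝒜} {a b : ℤ} {f : M.carrier →ₗ[A] N.carrier}
    {g : N.carrier →ₗ[A] P.carrier} (h : f ∈ homDeg M N a) (h' : g ∈ homDeg N P b) :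
    g ∘ₗ f ∈ homDeg M P (a + b) :=
  fun m x hx => by simpa [add_assoc] using h' _ _ (h m x hx)

/-- The graded category of graded `A`-modules; a morphism is a finite sum of homogeneous
`A`-linear maps. -/
instance : Category (GrMod k 𝒜) where
  Hom M N := ↥(⨆ n, homDeg M N n)
  id M := ⟨LinearMap.id, Submodule.mem_iSup_of_mem 0 (id_mem_homDeg M)⟩
  comp {M N P} f g := ⟨g.1 ∘ₗ f.1,
    GrLin.bilin_mem_iSup (LinearMap.mk₂ k
        (fun (f : M.carrier →ₗ[A] N.carrier) (g : N.carrier →ₗ[A] P.carrier) => g ∘ₗ f)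
        (fun f f' g => LinearMap.comp_add f f' g)
        (fun r f g => by
          ext x
          exact (g.restrictScalars k).map_smul r (f x))
        (fun f g g' => LinearMap.add_comp f g' g)
        (fun r f g => rfl)) (homDeg M N) (homDeg N P) (homDeg M P)
      (fun _ _ _ h _ h' => comp_mem_homDeg h h') f.2 g.2⟩

instance : Preadditive (GrMod k 𝒜) where
  homGroup M N := inferInstanceAs (AddCommGroup ↥(⨆ n, homDeg M N n))
  add_comp _ _ _ _ _ g := Subtype.ext (LinearMap.comp_add _ _ g.1)
  comp_add _ _ _ f _ _ := Subtype.ext (LinearMap.add_comp f.1 _ _)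

instance : Linear k (GrMod k 𝒜) where
  homModule M N := inferInstanceAs (Module k ↥(⨆ n, homDeg M N n))
  smul_comp _ _ _ r f g := Subtype.ext (LinearMap.ext fun x =>
    (g.1.restrictScalars k).map_smul r (f.1 x))
  comp_smul _ _ _ _ _ _ := Subtype.ext rfl

instance : GradedLinear k (GrMod k 𝒜) where
  deg M N n := (homDeg M N n).comap (⨆ m, homDeg M N m).subtype
  isInternal M N := GrLin.isInternal_comap_iSup _ (homDeg_indep M N)
  id_mem M := id_mem_homDeg M
  comp_mem h h' := comp_mem_homDeg h h'

end GrMod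

/-! ## Divided powers -/

namespace DividedPower

section

variable (k : Type u) [Field k] (d : ℕ) (M : Type u) [AddCommGroup M] [Module k M]

/-- The divided power `Γ^d(M) = (M^{⊗ d})^{Σ_d}`: tensors invariant under permutation of the
factors. -/
def Gam : Submodule k (⨂[k] _ : Fin d, M) where
  carrier := {t | ∀ σ : Equiv.Perm (Fin d), PiTensorProduct.reindex k (fun _ => M) σ t = t}
  add_mem' h h' σ := by rw [map_add, h σ, h' σ]
  zero_mem' σ := map_zero _
  smul_mem' r t h σ := by rw [map_smul, h σ]

noncomputable instance : AddCommGroup (Gam k d M) := Submodule.addCommGroup _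

noncomputable instance : Module k (Gam k d M) := Submodule.module _

variable {M}

/-- The grading of `M^{⊗ d}` by total degree, for a graded vector space `M`. -/
def tensorDeg (gr : ℤ → Submodule k M) (n : ℤ) : Submodule k (⨂[k] _ : Fin d, M) :=
  Submodule.span k {t | ∃ (a : Fin d → ℤ) (x : Fin d → M),
    (∀ j, x j ∈ gr (a j)) ∧ ∑ j, a j = n ∧ PiTensorProduct.tprod k x = t}

/-- The grading of `Γ^d(M)` by total degree. -/
noncomputable def gamDeg (gr : ℤ → Submodule k M) (n : ℤ) : Submodule k (Gam k d M) :=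
  (tensorDeg k d gr n).comap (Gam k d M).subtype

variable {k d}

theorem tensorDeg_isInternal {gr : ℤ → Submodule k M} (h : DirectSum.IsInternal gr) :
    DirectSum.IsInternal (tensorDeg k d gr) := by
  classical
  obtain ⟨ι, b, δ, h1, h2⟩ := GrLin.exists_basis gr h
  refine GrLin.isInternal_of_basis _ (Basis.piTensorProduct (R := k) fun _ : Fin d => b)
    (fun I => ∑ j, δ (I j)) ?_ ?_
  · intro n t ht I hI
    by_contra hne
    apply hI
    have hle : tensorDeg k d gr n ≤
        LinearMap.ker ((Basis.piTensorProduct (R := k) fun _ : Fin d => b).coord I) := by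
      refine Submodule.span_le.2 ?_
      rintro _ ⟨a, x, hx, ha, rfl⟩
      rw [SetLike.mem_coe, LinearMap.mem_ker, Module.Basis.coord_apply,
        Basis.piTensorProduct_repr_tprod_apply]
      by_contra h0
      rw [Finset.prod_eq_zero_iff] at h0
      push Not at h0
      apply hne
      rw [← ha]
      exact Finset.sum_congr rfl fun j _ => h1 _ _ (hx j) _ (h0 j (Finset.mem_univ j))
    simpa using hle ht
  · intro I
    rw [Basis.piTensorProduct_apply]
    exact Submodule.subset_span ⟨_, _, fun j => h2 (I j), rfl, rfl⟩

theorem reindex_tprod' (σ : Equiv.Perm (Fin d)) (x : Fin d → M) :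
    PiTensorProduct.reindex k (fun _ => M) σ (PiTensorProduct.tprod k x) =
      PiTensorProduct.tprod k fun j => x (σ.symm j) :=
  PiTensorProduct.reindex_tprod σ x

theorem reindex_mem_tensorDeg (gr : ℤ → Submodule k M) {n : ℤ} {t : ⨂[k] _ : Fin d, M}
    (ht : t ∈ tensorDeg k d gr n) (σ : Equiv.Perm (Fin d)) :
    PiTensorProduct.reindex k (fun _ => M) σ t ∈ tensorDeg k d gr n := by
  have hle : tensorDeg k d gr n ≤ (tensorDeg k d gr n).comap
      (PiTensorProduct.reindex k (fun _ => M) σ).toLinearMap := by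
    refine Submodule.span_le.2 ?_
    rintro _ ⟨a, x, hx, ha, rfl⟩
    refine Submodule.subset_span ⟨fun j => a (σ.symm j), fun j => x (σ.symm j),
      fun j => hx _, ?_, ?_⟩
    · rw [← ha]
      exact Equiv.sum_comp σ.symm a
    · exact (reindex_tprod' σ x).symm
  exact hle ht

theorem gamDeg_isInternal {gr : ℤ → Submodule k M} (h : DirectSum.IsInternal gr) :
    DirectSum.IsInternal (gamDeg k d gr) := by
  classical
  have hT := tensorDeg_isInternal (d := d) h
  rw [DirectSum.isInternal_submodule_iff_iSupIndep_and_iSup_eq_top]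
  constructor
  · exact GrLin.iSupIndep_of_family (k := k) (S := Unit) (M := fun _ => ⨂[k] _ : Fin d, M) _
      (fun _ => (Gam k d M).subtype) (fun _ => tensorDeg k d gr)
      (fun _ => hT.submodule_iSupIndep) (fun _ n x hx => hx) fun x hx => by simpa using hx ()
  · rw [eq_top_iff]
    rintro ⟨t, ht⟩ -
    let _ := hT.chooseDecomposition
    have hinv : ∀ n, (DirectSum.decompose (tensorDeg k d gr) t n : ⨂[k] _ : Fin d, M) ∈
        Gam k d M := by
      intro n σ
      have e : ∀ s : ⨂[k] _ : Fin d, M,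
          PiTensorProduct.reindex k (fun _ => M) σ (DirectSum.decompose (tensorDeg k d gr) s n) =
          (DirectSum.decompose (tensorDeg k d gr)
            (PiTensorProduct.reindex k (fun _ => M) σ s) n : ⨂[k] _ : Fin d, M) := by
        intro s
        induction s using DirectSum.Decomposition.inductionOn (tensorDeg k d gr) with
        | zero => simp
        | @homogeneous m s =>
          by_cases hm : m = n
          · subst hm
            rw [DirectSum.decompose_of_mem_same _ s.2,
              DirectSum.decompose_of_mem_same _ (reindex_mem_tensorDeg gr s.2 σ)]
          · rw [DirectSum.decompose_of_mem_ne _ s.2 hm,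
              DirectSum.decompose_of_mem_ne _ (reindex_mem_tensorDeg gr s.2 σ) hm, map_zero]
        | add x y hx hy =>
          simp only [map_add, DirectSum.decompose_add, DirectSum.add_apply, Submodule.coe_add,
            hx, hy]
      rw [e, ht σ]
    have hs : (⟨t, ht⟩ : Gam k d M) = ∑ n ∈ (DirectSum.decompose (tensorDeg k d gr) t).support,
        ⟨_, hinv n⟩ := by
      apply Subtype.ext
      rw [AddSubmonoidClass.coe_finsetSum]
      exact (DirectSum.sum_support_decompose _ t).symm
    rw [hs]
    refine sum_mem fun n _ => Submodule.mem_iSup_of_mem n ?_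
    exact SetLike.coe_mem (DirectSum.decompose (tensorDeg k d gr) t n)

variable {M' M'' : Type u} [AddCommGroup M'] [Module k M'] [AddCommGroup M''] [Module k M'']

theorem map₂_mem_Gam (B : M →ₗ[k] M' →ₗ[k] M'') {s : ⨂[k] _ : Fin d, M} (hs : s ∈ Gam k d M)
    {t : ⨂[k] _ : Fin d, M'} (ht : t ∈ Gam k d M') :
    PiTensorProduct.map₂ (fun _ => B) s t ∈ Gam k d M'' := by
  intro σ
  have e : ∀ (s : ⨂[k] _ : Fin d, M) (t : ⨂[k] _ : Fin d, M'),
      PiTensorProduct.reindex k (fun _ => M'') σ (PiTensorProduct.map₂ (fun _ => B) s t) =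
      PiTensorProduct.map₂ (fun _ => B) (PiTensorProduct.reindex k (fun _ => M) σ s)
        (PiTensorProduct.reindex k (fun _ => M') σ t) := by
    intro s t
    induction s using PiTensorProduct.induction_on with
    | add x y hx hy => simp only [map_add, LinearMap.add_apply, hx, hy]
    | smul_tprod r x =>
      induction t using PiTensorProduct.induction_on with
      | add x y hx hy => simp only [map_add, hx, hy]
      | smul_tprod r' y =>
        simp only [map_smul, LinearMap.smul_apply, PiTensorProduct.map₂_tprod_tprod,
          reindex_tprod']
  rw [e, hs σ, ht σ]

theorem map₂_mem_tensorDeg (B : M →ₗ[k] M' →ₗ[k] M'') {gr : ℤ → Submodule k M}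
    {gr' : ℤ → Submodule k M'} {gr'' : ℤ → Submodule k M''}
    (hB : ∀ a b, ∀ x ∈ gr a, ∀ y ∈ gr' b, B x y ∈ gr'' (a + b)) {m n : ℤ}
    {s : ⨂[k] _ : Fin d, M} (hs : s ∈ tensorDeg k d gr m)
    {t : ⨂[k] _ : Fin d, M'} (ht : t ∈ tensorDeg k d gr' n) :
    PiTensorProduct.map₂ (fun _ => B) s t ∈ tensorDeg k d gr'' (m + n) := by
  induction hs using Submodule.span_induction with
  | zero => simp
  | add x y _ _ hx hy =>
    rw [map_add, LinearMap.add_apply]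
    exact add_mem hx hy
  | smul r x _ hx =>
    rw [map_smul, LinearMap.smul_apply]
    exact Submodule.smul_mem _ r hx
  | mem s hs =>
    obtain ⟨a, x, hx, ha, rfl⟩ := hs
    induction ht using Submodule.span_induction with
    | zero => simp
    | add x y _ _ hx hy =>
      rw [map_add]
      exact add_mem hx hy
    | smul r x _ hx =>
      rw [map_smul]
      exact Submodule.smul_mem _ r hx
    | mem t ht =>
      obtain ⟨b, y, hy, hb, rfl⟩ := ht
      rw [PiTensorProduct.map₂_tprod_tprod]
      refine Submodule.subset_span ⟨fun j => a j + b j, _, fun j => hB _ _ _ (hx j) _ (hy j), ?_, rfl⟩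
      rw [Finset.sum_add_distrib, ha, hb]

end

section Hom

variable (k : Type u) [Field k] {A : Type u} [CommRing A] [Algebra k A] (𝒜 : ℤ → Submodule k A)
  (U V W : Type u) [AddCommGroup U] [Module k U] [AddCommGroup V] [Module k V]
  [AddCommGroup W] [Module k W]

/-- The grading of `Hom(V, W) ⊗ A` induced by that of `A`. -/
def homTensorDeg (n : ℤ) : Submodule k ((V →ₗ[k] W) ⊗[k] A) :=
  Submodule.span k {t | ∃ (f : V →ₗ[k] W) (a : A), a ∈ 𝒜 n ∧ f ⊗ₜ[k] a = t}

variable (A) in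
/-- The composition `(f ⊗ a, g ⊗ b) ↦ (g ∘ f) ⊗ ab`. -/
noncomputable def homTensorComp :
    ((U →ₗ[k] V) ⊗[k] A) →ₗ[k] ((V →ₗ[k] W) ⊗[k] A) →ₗ[k] ((U →ₗ[k] W) ⊗[k] A) :=
  TensorProduct.map₂ (LinearMap.llcomp k U V W).flip (LinearMap.mul k A)

variable {k U V W}

theorem homTensorComp_tmul (f : U →ₗ[k] V) (g : V →ₗ[k] W) (a b : A) :
    homTensorComp k A U V W (f ⊗ₜ a) (g ⊗ₜ b) = (g ∘ₗ f) ⊗ₜ (a * b) := rfl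

theorem homTensorDeg_isInternal (h : DirectSum.IsInternal 𝒜) :
    DirectSum.IsInternal (homTensorDeg k 𝒜 V W) := by
  classical
  obtain ⟨ι, b, δ, h1, h2⟩ := GrLin.exists_basis 𝒜 h
  let c := Module.Basis.ofVectorSpace k (V →ₗ[k] W)
  refine GrLin.isInternal_of_basis _ (c.tensorProduct b) (fun I => δ I.2) ?_ ?_
  · intro n t ht I hI
    by_contra hne
    apply hI
    have hle : homTensorDeg k 𝒜 V W n ≤ LinearMap.ker ((c.tensorProduct b).coord I) := by
      refine Submodule.span_le.2 ?_
      rintro _ ⟨f, a, ha, rfl⟩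
      rw [SetLike.mem_coe, LinearMap.mem_ker, Module.Basis.coord_apply,
        Module.Basis.tensorProduct_repr_tmul_apply]
      by_contra h0
      refine hne (h1 n a ha I.2 fun h3 => h0 ?_)
      rw [h3]
      simp
    simpa using hle ht
  · intro I
    rw [Module.Basis.tensorProduct_apply']
    exact Submodule.subset_span ⟨_, _, h2 I.2, rfl⟩

theorem homTensorComp_mem [SetLike.GradedMonoid 𝒜] (a b : ℤ) (x : (U →ₗ[k] V) ⊗[k] A)
    (hx : x ∈ homTensorDeg k 𝒜 U V a) (y : (V →ₗ[k] W) ⊗[k] A)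
    (hy : y ∈ homTensorDeg k 𝒜 V W b) :
    homTensorComp k A U V W x y ∈ homTensorDeg k 𝒜 U W (a + b) := by
  induction hx using Submodule.span_induction with
  | zero => simp
  | add x y _ _ hx hy =>
    rw [map_add, LinearMap.add_apply]
    exact add_mem hx hy
  | smul r x _ hx =>
    rw [map_smul, LinearMap.smul_apply]
    exact Submodule.smul_mem _ r hx
  | mem s hs =>
    obtain ⟨f, c, hc, rfl⟩ := hs
    induction hy using Submodule.span_induction with
    | zero => simp
    | add x y _ _ hx hy =>
      rw [map_add]
      exact add_mem hx hy
    | smul r x _ hx =>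
      rw [map_smul]
      exact Submodule.smul_mem _ r hx
    | mem t ht =>
      obtain ⟨g, e, he, rfl⟩ := ht
      rw [homTensorComp_tmul]
      exact Submodule.subset_span ⟨_, _, SetLike.mul_mem_graded hc he, rfl⟩

variable {T : Type u} [AddCommGroup T] [Module k T]

theorem homTensorComp_assoc (x : (T →ₗ[k] U) ⊗[k] A) (y : (U →ₗ[k] V) ⊗[k] A)
    (z : (V →ₗ[k] W) ⊗[k] A) :
    homTensorComp k A T V W (homTensorComp k A T U V x y) z =
      homTensorComp k A T U W x (homTensorComp k A U V W y z) := by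
  induction x with
  | zero => simp
  | add x x' h h' => simp only [map_add, LinearMap.add_apply, h, h']
  | tmul f a =>
    induction y with
    | zero => simp
    | add x x' h h' => simp only [map_add, LinearMap.add_apply, h, h']
    | tmul g b =>
      induction z with
      | zero => simp
      | add x x' h h' => simp only [map_add, h, h']
      | tmul g b => simp only [homTensorComp_tmul, LinearMap.comp_assoc, mul_assoc]

theorem id_homTensorComp (x : (U →ₗ[k] V) ⊗[k] A) :
    homTensorComp k A U U V (LinearMap.id ⊗ₜ 1) x = x := by
  induction x with
  | zero => simp
  | add x x' h h' => simp only [map_add, h, h']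
  | tmul f a => simp only [homTensorComp_tmul, LinearMap.comp_id, one_mul]

theorem homTensorComp_id (x : (U →ₗ[k] V) ⊗[k] A) :
    homTensorComp k A U V V x (LinearMap.id ⊗ₜ 1) = x := by
  induction x with
  | zero => simp
  | add x x' h h' => simp only [map_add, LinearMap.add_apply, h, h']
  | tmul f a => simp only [homTensorComp_tmul, LinearMap.id_comp, mul_one]

end Hom

end DividedPower

/-- The objects of the graded category `Γ^d 𝒱_A`: finite dimensional vector spaces `V`, thought of
as labels for `V ⊗ A`. Here `A` is a commutative algebra with a grading `𝒜` concentrated in even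
degrees. -/
structure DivPowCat (k : Type u) [Field k] {A : Type u} [CommRing A] [Algebra k A]
    (𝒜 : ℤ → Submodule k A) (d : ℕ) where
  carrier : Type u
  [addCommGroup : AddCommGroup carrier]
  [module : Module k carrier]
  [finite : Module.Finite k carrier]

namespace DivPowCat

attribute [instance] addCommGroup module finite

open DividedPower

variable {k : Type u} [Field k] {A : Type u} [CommRing A] [Algebra k A] {𝒜 : ℤ → Submodule k A}
  {d : ℕ}

/-- Morphisms `V ⊗ A → W ⊗ A` are the elements of `Γ^d(Hom(V, W) ⊗ A)`; the composition is induced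
on `d`-th tensor powers by the composition of `Hom(V, W) ⊗ A`. -/
noncomputable instance : Category (DivPowCat k 𝒜 d) where
  Hom V W := ↥(Gam k d ((V.carrier →ₗ[k] W.carrier) ⊗[k] A))
  id V := ⟨PiTensorProduct.tprod k fun _ => LinearMap.id ⊗ₜ 1,
    fun σ => PiTensorProduct.reindex_tprod σ _⟩
  comp {U V W} f g :=
    ⟨PiTensorProduct.map₂ (fun _ => homTensorComp k A U.carrier V.carrier W.carrier) f.1 g.1,
      map₂_mem_Gam _ f.2 g.2⟩
  id_comp {U V} f := by
    refine Subtype.ext ?_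
    change PiTensorProduct.map₂ _ _ f.1 = f.1
    induction f.1 using PiTensorProduct.induction_on with
    | add x y hx hy => rw [map_add, hx, hy]
    | smul_tprod r x =>
      simp only [map_smul, PiTensorProduct.map₂_tprod_tprod, id_homTensorComp]
  comp_id {U V} f := by
    refine Subtype.ext ?_
    change PiTensorProduct.map₂ _ f.1 _ = f.1
    induction f.1 using PiTensorProduct.induction_on with
    | add x y hx hy => rw [map_add, LinearMap.add_apply, hx, hy]
    | smul_tprod r x =>
      simp only [map_smul, LinearMap.smul_apply, PiTensorProduct.map₂_tprod_tprod,
        homTensorComp_id]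
  assoc {T U V W} f g h := by
    refine Subtype.ext ?_
    change PiTensorProduct.map₂ _ (PiTensorProduct.map₂ _ f.1 g.1) h.1 =
      PiTensorProduct.map₂ _ f.1 (PiTensorProduct.map₂ _ g.1 h.1)
    generalize f.1 = x, g.1 = y, h.1 = z
    induction x using PiTensorProduct.induction_on with
    | add x y hx hy => simp only [map_add, LinearMap.add_apply, hx, hy]
    | smul_tprod r x =>
      induction y using PiTensorProduct.induction_on with
      | add x y hx hy => simp only [map_add, LinearMap.add_apply, hx, hy]
      | smul_tprod r y =>
        induction z using PiTensorProduct.induction_on with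
        | add x y hx hy => simp only [map_add, hx, hy]
        | smul_tprod r z =>
          simp only [map_smul, LinearMap.smul_apply, PiTensorProduct.map₂_tprod_tprod,
            homTensorComp_assoc]

noncomputable instance : Preadditive (DivPowCat k 𝒜 d) where
  homGroup V W := inferInstanceAs
    (AddCommGroup ↥(Gam k d ((V.carrier →ₗ[k] W.carrier) ⊗[k] A)))
  add_comp _ _ _ _ _ _ := Subtype.ext (LinearMap.map_add₂ _ _ _ _)
  comp_add _ _ _ _ _ _ := Subtype.ext (map_add _ _ _)

noncomputable instance : Linear k (DivPowCat k 𝒜 d) where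
  homModule V W := inferInstanceAs
    (Module k ↥(Gam k d ((V.carrier →ₗ[k] W.carrier) ⊗[k] A)))
  smul_comp _ _ _ _ _ _ := Subtype.ext (LinearMap.map_smul₂ _ _ _ _)
  comp_smul _ _ _ _ _ _ := Subtype.ext (map_smul _ _ _)

noncomputable instance [GradedAlgebra 𝒜] : GradedLinear k (DivPowCat k 𝒜 d) where
  deg V W n := gamDeg k d (homTensorDeg k 𝒜 V.carrier W.carrier) n
  isInternal V W := gamDeg_isInternal
    (homTensorDeg_isInternal 𝒜 (DirectSum.Decomposition.isInternal 𝒜))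
  id_mem V := Submodule.subset_span ⟨fun _ => 0, fun _ => LinearMap.id ⊗ₜ 1,
    fun _ => Submodule.subset_span ⟨_, _, SetLike.one_mem_graded 𝒜, rfl⟩, by simp, rfl⟩
  comp_mem h h' := map₂_mem_tensorDeg _ (homTensorComp_mem 𝒜) h h'

end DivPowCat

/-! ## The truncated polynomial algebra and affine strict polynomial functors -/

/-- `A_i = k[x_1, …, x_i] / (x_1^p, …, x_i^p)`. -/
abbrev TruncPoly (k : Type u) [Field k] (p i : ℕ) : Type u :=
  MvPolynomial (Fin i) k ⧸
    Ideal.span (Set.range fun j : Fin i => (MvPolynomial.X j : MvPolynomial (Fin i) k) ^ p)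

namespace TruncPoly

variable {k : Type u} [Field k] {p i : ℕ}

/-- The grading of `A_i` in which (the class of) `x_j` has degree `w j`. -/
noncomputable def grading (k : Type u) [Field k] (p : ℕ) {i : ℕ} (w : Fin i → ℤ) (n : ℤ) :
    Submodule k (TruncPoly k p i) :=
  (MvPolynomial.weightedHomogeneousSubmodule k w n).map (Ideal.Quotient.mkₐ k _).toLinearMap

/-- The coaction `x_j ↦ x_j T^{w j}` attached to a grading. -/
noncomputable def coaction (k : Type u) [Field k] (p : ℕ) {i : ℕ} (w : Fin i → ℤ) :
    TruncPoly k p i →ₐ[k] AddMonoidAlgebra (TruncPoly k p i) ℤ :=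
  Ideal.Quotient.liftₐ _ (MvPolynomial.aeval (R := k) fun j =>
    (AddMonoidAlgebra.single (w j) (Ideal.Quotient.mk _ (MvPolynomial.X j)) :
      AddMonoidAlgebra (TruncPoly k p i) ℤ)) <| by
    intro a ha
    have hle : Ideal.span (Set.range fun j : Fin i =>
        (MvPolynomial.X j : MvPolynomial (Fin i) k) ^ p) ≤
        RingHom.ker (MvPolynomial.aeval (R := k) fun j : Fin i =>
          (AddMonoidAlgebra.single (w j) (Ideal.Quotient.mk _ (MvPolynomial.X j)) :
            AddMonoidAlgebra (TruncPoly k p i) ℤ)) := by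
      rw [Ideal.span_le]
      rintro _ ⟨j, rfl⟩
      rw [SetLike.mem_coe, RingHom.mem_ker, map_pow, MvPolynomial.aeval_X,
        AddMonoidAlgebra.single_pow, ← map_pow,
        Ideal.Quotient.eq_zero_iff_mem.2 (Ideal.subset_span (Set.mem_range_self j)),
        AddMonoidAlgebra.single_zero]
    exact hle ha

theorem coaction_monomial (w : Fin i → ℤ) (e : Fin i →₀ ℕ) :
    coaction k p w (Ideal.Quotient.mk _ (MvPolynomial.monomial e 1)) =
      AddMonoidAlgebra.single (Finsupp.weight w e)
        (Ideal.Quotient.mk _ (MvPolynomial.monomial e 1)) := by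
  induction e using Finsupp.induction_linear with
  | zero =>
    rw [map_zero, show MvPolynomial.monomial (0 : Fin i →₀ ℕ) (1 : k) = 1 from rfl, map_one,
      map_one]
    rfl
  | add e e' h h' =>
    rw [show MvPolynomial.monomial (e + e') (1 : k) =
      MvPolynomial.monomial e 1 * MvPolynomial.monomial e' 1 by
        rw [MvPolynomial.monomial_mul, one_mul], map_mul, map_mul, h, h',
      AddMonoidAlgebra.single_mul_single, map_add]
  | single j n =>
    rw [← MvPolynomial.X_pow_eq_monomial, map_pow, map_pow]
    have : coaction k p w (Ideal.Quotient.mk _ (MvPolynomial.X j)) =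
        AddMonoidAlgebra.single (w j) (Ideal.Quotient.mk _ (MvPolynomial.X j)) := by
      change MvPolynomial.aeval _ _ = _
      rw [MvPolynomial.aeval_X]
    rw [this, AddMonoidAlgebra.single_pow, Finsupp.weight_single]

theorem coaction_of_mem (w : Fin i → ℤ) (n : ℤ) (x : TruncPoly k p i)
    (hx : x ∈ grading k p w n) : coaction k p w x = AddMonoidAlgebra.single n x := by
  obtain ⟨f, hf, rfl⟩ := hx
  change coaction k p w (Ideal.Quotient.mkₐ k _ f) =
    AddMonoidAlgebra.single n (Ideal.Quotient.mkₐ k _ f)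
  rw [f.as_sum, map_sum, map_sum, ← AddMonoidAlgebra.lsingle_apply (R := k), map_sum]
  refine Finset.sum_congr rfl fun e he => ?_
  have hw : Finsupp.weight w e = n := hf (MvPolynomial.mem_support_iff.1 he)
  rw [show MvPolynomial.monomial e (f.coeff e) = f.coeff e • MvPolynomial.monomial e (1 : k) by
    rw [MvPolynomial.smul_monomial, smul_eq_mul, mul_one], map_smul, map_smul, ← hw]
  erw [coaction_monomial]
  rw [AddMonoidAlgebra.smul_single]
  rfl

theorem grading_isInternal (w : Fin i → ℤ) : DirectSum.IsInternal (grading k p w) := by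
  classical
  rw [DirectSum.isInternal_submodule_iff_iSupIndep_and_iSup_eq_top]
  constructor
  · rw [iSupIndep_def]
    intro n
    rw [Submodule.disjoint_def]
    intro x hx hx'
    let L : TruncPoly k p i →ₗ[k] TruncPoly k p i := Finsupp.lapply n ∘ₗ
      (AddMonoidAlgebra.coeffLinearEquiv k).toLinearMap ∘ₗ (coaction k p w).toLinearMap
    have hL : ∀ m, ∀ y ∈ grading k p w m, L y = if m = n then y else 0 := by
      intro m y hy
      change (coaction k p w y).coeff n = _
      rw [coaction_of_mem w m y hy, AddMonoidAlgebra.coeff_single, Finsupp.single_apply]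
    have hle : (⨆ (j : ℤ) (_ : j ≠ n), grading k p w j) ≤ LinearMap.ker L := by
      refine iSup₂_le fun m hm y hy => ?_
      rw [LinearMap.mem_ker, hL m y hy, if_neg hm]
    rw [← (hL n x hx).trans (if_pos rfl)]
    exact hle hx'
  · have h := (MvPolynomial.weightedDecomposition k w).isInternal.submodule_iSup_eq_top
    have hr : LinearMap.range (Ideal.Quotient.mkₐ k (Ideal.span (Set.range
        fun j : Fin i => (MvPolynomial.X j : MvPolynomial (Fin i) k) ^ p))).toLinearMap = ⊤ :=
      LinearMap.range_eq_top.2 (Ideal.Quotient.mkₐ_surjective k _)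
    rw [← hr, LinearMap.range_eq_map, ← h, Submodule.map_iSup]
    rfl

instance (w : Fin i → ℤ) : SetLike.GradedMonoid (grading k p w) where
  one_mem := ⟨1, MvPolynomial.isWeightedHomogeneous_one k w, map_one (Ideal.Quotient.mk _)⟩
  mul_mem := by
    rintro a b _ _ ⟨f, hf, rfl⟩ ⟨g, hg, rfl⟩
    exact ⟨f * g, MvPolynomial.IsWeightedHomogeneous.mul hf hg, map_mul (Ideal.Quotient.mk _) _ _⟩

noncomputable instance (w : Fin i → ℤ) : GradedAlgebra (grading k p w) where
  toDecomposition := (grading_isInternal w).chooseDecomposition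

end TruncPoly

/-- The graded category `𝒫_d^{af_i}` of `i`-affine strict polynomial functors of degree `d`, where
the generator `x_j` of `A_i` has degree `w j`. -/
abbrev AffineFunctor (k : Type u) [Field k] (p : ℕ) {i : ℕ} (w : Fin i → ℤ) (d : ℕ) :=
  GradedFunctor k (DivPowCat k (TruncPoly.grading k p w) d) (GrVec k)

/-!
The equivalence holds for every commutative algebra `A` with a `ℤ`-grading `𝒜`; the shape of the
truncated polynomial algebra plays no role. As `Γ¹(X) = X`, the category `Γ¹ 𝒱_A` has
`Hom(V, W) ⊗ A` as its morphism spaces (`DivPowCat.homEquiv`), so it is the category of finite free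
`A`-modules with a chosen `k`-form, and a `k`-linear functor on it is determined, up to isomorphism,
by its value at the rank one object `k ⊗ A`, whose endomorphism algebra is `A`.

One functor evaluates at `k ⊗ A` (`GradedFunctor.evaluation`), where `a` acts through `F(id ⊗ a)`.
The other sends a graded module `M` to `V ↦ V ⊗ M`, on which `f ⊗ a` acts by `f ⊗ a`
(`GrMod.toAffine`). The comparison map `V ⊗ F(k) → F(V)`, `v ⊗ x ↦ F(1 ↦ v)(x)`, is natural, and
expanding `id_V = ∑ e_j ⊗ e_j^*` in a basis of `V` shows that `x ↦ ∑ e_j ⊗ F(e_j^*)(x)` is its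
inverse (`GradedFunctor.assemble_disassemble`, `GradedFunctor.disassemble_assemble`). In the other
direction `k ⊗ M = M`. All these maps have degree `0`, because they only involve the degree `0`
morphisms `f ⊗ 1`. Morphisms of all the categories in play are finite sums of homogeneous ones, so
whatever is linear in a morphism and preserves homogeneous components is well defined on them
(`GrLin.map_mem_iSup`).
-/

namespace GrLin

/-- A linear map that respects homogeneous elements respects their finite sums. -/
theorem map_mem_iSup {k H H' : Type*} [Field k] [AddCommGroup H] [Module k H] [AddCommGroup H']
    [Module k H'] (L : H →ₗ[k] H') {D : ℤ → Submodule k H} {D' : ℤ → Submodule k H'}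
    (h : ∀ n, ∀ x ∈ D n, L x ∈ D' n) {x : H} (hx : x ∈ ⨆ n, D n) : L x ∈ ⨆ n, D' n := by
  have hle : (⨆ n, D n) ≤ (⨆ n, D' n).comap L :=
    iSup_le fun n y hy => Submodule.mem_iSup_of_mem n (h n y hy)
  exact hle hx

end GrLin

/-! ### The category of first divided powers -/

namespace DividedPower

variable (k : Type u) [Field k] (M : Type u) [AddCommGroup M] [Module k M]

/-- The identification of `M` with `Γ¹(M)`. -/
noncomputable def gamOne : M ≃ₗ[k] Gam k 1 M :=
  (PiTensorProduct.subsingletonEquiv (R := k) (s := fun _ => M) (0 : Fin 1)).symm ≪≫ₗ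
    (LinearEquiv.ofTop (Gam k 1 M) (by
      refine eq_top_iff.2 fun t _ σ => ?_
      rw [Subsingleton.elim σ (Equiv.refl _), PiTensorProduct.reindex_refl]
      rfl)).symm

variable {k M}

theorem coe_gamOne (x : M) :
    (gamOne k M x : ⨂[k] _ : Fin 1, M) = PiTensorProduct.tprod k fun _ => x :=
  PiTensorProduct.subsingletonEquiv_symm_apply' _ _

theorem gamOne_symm_mem {gr : ℤ → Submodule k M} {n : ℤ} {t : Gam k 1 M}
    (ht : t ∈ gamDeg k 1 gr n) : (gamOne k M).symm t ∈ gr n := by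
  have hle : tensorDeg k 1 gr n ≤ (gr n).comap
      (PiTensorProduct.subsingletonEquiv (R := k) (s := fun _ => M) (0 : Fin 1)).toLinearMap := by
    refine Submodule.span_le.2 ?_
    rintro _ ⟨a, x, hx, ha, rfl⟩
    rw [Fin.sum_univ_one] at ha
    simpa [← ha] using hx 0
  exact hle ht

theorem gamOne_mem {gr : ℤ → Submodule k M} {n : ℤ} {x : M} (hx : x ∈ gr n) :
    gamOne k M x ∈ gamDeg k 1 gr n :=
  Submodule.subset_span ⟨fun _ => n, fun _ => x, fun _ => hx, by simp, (coe_gamOne x).symm⟩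

end DividedPower

namespace DivPowCat

open DividedPower

variable {k : Type u} [Field k] {A : Type u} [CommRing A] [Algebra k A] {𝒜 : ℤ → Submodule k A}

/-- In `Γ¹ 𝒱_A`, morphisms `V ⊗ A → W ⊗ A` are the elements of `Hom(V, W) ⊗ A`. -/
noncomputable def homEquiv (V W : DivPowCat k 𝒜 1) :
    ((V.carrier →ₗ[k] W.carrier) ⊗[k] A) ≃ₗ[k] (V ⟶ W) :=
  gamOne k ((V.carrier →ₗ[k] W.carrier) ⊗[k] A)

theorem homEquiv_one (V : DivPowCat k 𝒜 1) : homEquiv V V (LinearMap.id ⊗ₜ 1) = 𝟙 V :=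
  Subtype.ext (coe_gamOne _)

theorem homEquiv_comp {U V W : DivPowCat k 𝒜 1} (x : (U.carrier →ₗ[k] V.carrier) ⊗[k] A)
    (y : (V.carrier →ₗ[k] W.carrier) ⊗[k] A) :
    homEquiv U V x ≫ homEquiv V W y =
      homEquiv U W (homTensorComp k A U.carrier V.carrier W.carrier x y) := by
  refine Subtype.ext ?_
  change PiTensorProduct.map₂ _ (gamOne k _ x).1 (gamOne k _ y).1 = (gamOne k _ _).1
  rw [coe_gamOne, coe_gamOne, coe_gamOne, PiTensorProduct.map₂_tprod_tprod]

theorem homEquiv_tmul_comp {U V W : DivPowCat k 𝒜 1} (f : U.carrier →ₗ[k] V.carrier)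
    (g : V.carrier →ₗ[k] W.carrier) (a b : A) :
    homEquiv U V (f ⊗ₜ a) ≫ homEquiv V W (g ⊗ₜ b) = homEquiv U W ((g ∘ₗ f) ⊗ₜ (a * b)) :=
  homEquiv_comp _ _

theorem homEquiv_symm_one (V : DivPowCat k 𝒜 1) :
    (homEquiv V V).symm (𝟙 V) = LinearMap.id ⊗ₜ 1 := by
  rw [← homEquiv_one, LinearEquiv.symm_apply_apply]

theorem homEquiv_symm_comp {U V W : DivPowCat k 𝒜 1} (f : U ⟶ V) (g : V ⟶ W) :
    (homEquiv U W).symm (f ≫ g) = homTensorComp k A U.carrier V.carrier W.carrier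
      ((homEquiv U V).symm f) ((homEquiv V W).symm g) := by
  rw [LinearEquiv.symm_apply_eq, ← homEquiv_comp, LinearEquiv.apply_symm_apply,
    LinearEquiv.apply_symm_apply]

variable [GradedAlgebra 𝒜]

theorem homEquiv_tmul_mem {V W : DivPowCat k 𝒜 1} (f : V.carrier →ₗ[k] W.carrier) {a : A} {n : ℤ}
    (ha : a ∈ 𝒜 n) : homEquiv V W (f ⊗ₜ a) ∈ GradedLinear.deg (k := k) V W n :=
  gamOne_mem (gr := homTensorDeg k 𝒜 V.carrier W.carrier) (Submodule.subset_span ⟨f, a, ha, rfl⟩)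

theorem homEquiv_symm_mem {V W : DivPowCat k 𝒜 1} {f : V ⟶ W} {n : ℤ}
    (hf : f ∈ GradedLinear.deg (k := k) V W n) :
    (homEquiv V W).symm f ∈ homTensorDeg k 𝒜 V.carrier W.carrier n :=
  gamOne_symm_mem hf

end DivPowCat

/-! ### Tensoring a graded module with finite dimensional vector spaces -/

namespace GrVec

variable {k : Type u} [Field k]

/-- The graded vector space `V ⊗ M`, with `V` finite dimensional in degree `0`. -/
noncomputable abbrev tensor (V : Type u) [AddCommGroup V] [Module k V] [Module.Finite k V]
    (M : GrVec k) : GrVec k where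
  carrier := V ⊗[k] M.carrier
  gr n := LinearMap.range ((M.gr n).subtype.lTensor V)
  isInternal := by
    obtain ⟨ι, b, δ, h1, h2⟩ := GrLin.exists_basis M.gr M.isInternal
    let c := Module.Basis.ofVectorSpace k V
    refine GrLin.isInternal_of_basis _ (c.tensorProduct b) (fun I => δ I.2) ?_ ?_
    · rintro n _ ⟨t, rfl⟩ I hI
      by_contra hne
      refine hI ?_
      clear hI
      induction t with
      | zero => simp
      | add x y hx hy => rw [map_add, map_add, Finsupp.add_apply, hx, hy, add_zero]
      | tmul v x =>
        rw [LinearMap.lTensor_tmul, Module.Basis.tensorProduct_repr_tmul_apply]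
        have : b.repr x I.2 = 0 := by
          by_contra h
          exact hne (h1 n x x.2 I.2 h)
        simp [this]
    · intro I
      rw [Module.Basis.tensorProduct_apply']
      exact ⟨c I.1 ⊗ₜ ⟨b I.2, h2 I.2⟩, rfl⟩
  finite n := by
    have := M.finite n
    exact Module.Finite.range _
  boundedBelow := by
    obtain ⟨N, hN⟩ := M.boundedBelow
    refine ⟨N, fun n hn => ?_⟩
    rw [LinearMap.range_eq_bot]
    ext v x
    have : (x : M.carrier) = 0 := by simpa [hN n hn] using x.2
    simp [this]

variable {V W : Type u} [AddCommGroup V] [Module k V] [Module.Finite k V]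
  [AddCommGroup W] [Module k W] [Module.Finite k W]

theorem tmul_mem_tensor {M : GrVec k} (v : V) {x : M.carrier} {n : ℤ} (hx : x ∈ M.gr n) :
    v ⊗ₜ[k] x ∈ (tensor V M).gr n :=
  ⟨v ⊗ₜ ⟨x, hx⟩, rfl⟩

/-- Degrees of linear maps out of `V ⊗ M` can be checked on pure tensors. -/
theorem mem_homDeg_tensor {M N : GrVec k} {f : V ⊗[k] M.carrier →ₗ[k] N.carrier} {n : ℤ}
    (h : ∀ v m, ∀ x ∈ M.gr m, f (v ⊗ₜ x) ∈ N.gr (m + n)) : f ∈ homDeg (tensor V M) N n := by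
  rintro m _ ⟨t, rfl⟩
  change (f ∘ₗ (M.gr m).subtype.lTensor V) t ∈ N.gr (m + n)
  induction t with
  | zero => rw [map_zero]; exact zero_mem _
  | add x y hx hy =>
    rw [map_add]
    exact add_mem hx hy
  | tmul v x => exact h v m x x.2

end GrVec

namespace GrVec

variable {k : Type u} [Field k]

/-- A homogeneous linear map as a morphism of graded vector spaces. -/
def homMk {M N : GrVec k} {n : ℤ} (f : M.carrier →ₗ[k] N.carrier) (hf : f ∈ homDeg M N n) :
    M ⟶ N :=
  ⟨f, Submodule.mem_iSup_of_mem n hf⟩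

/-- Two mutually inverse linear maps of degree `0` are an isomorphism of graded vector spaces. -/
def isoMk {M N : GrVec k} (f : M.carrier →ₗ[k] N.carrier) (g : N.carrier →ₗ[k] M.carrier)
    (hf : f ∈ homDeg M N 0) (hg : g ∈ homDeg N M 0) (hfg : g ∘ₗ f = LinearMap.id)
    (hgf : f ∘ₗ g = LinearMap.id) : M ≅ N where
  hom := homMk f hf
  inv := homMk g hg
  hom_inv_id := Subtype.ext hfg
  inv_hom_id := Subtype.ext hgf

end GrVec

/-! ### From graded modules to affine functors of degree one -/

namespace GrMod

open DividedPower

variable {k : Type u} [Field k] {A : Type u} [CommRing A] [Algebra k A] {𝒜 : ℤ → Submodule k A}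

section Action

variable (M : GrMod k 𝒜) (U V W : Type u) [AddCommGroup U] [Module k U] [AddCommGroup V]
  [Module k V] [AddCommGroup W] [Module k W]

/-- The element `f ⊗ a` of `Hom(V, W) ⊗ A` acts as `v ⊗ x ↦ f v ⊗ a x`. -/
noncomputable def tensorAct :
    ((V →ₗ[k] W) ⊗[k] A) →ₗ[k] (V ⊗[k] M.carrier →ₗ[k] W ⊗[k] M.carrier) :=
  TensorProduct.homTensorHomMap (RingHom.id k) V M.carrier W M.carrier ∘ₗ
    (Algebra.lsmul k k M.carrier).toLinearMap.lTensor (V →ₗ[k] W)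

variable {U V W}

theorem tensorAct_tmul (f : V →ₗ[k] W) (a : A) (v : V) (x : M.carrier) :
    M.tensorAct V W (f ⊗ₜ a) (v ⊗ₜ x) = f v ⊗ₜ (a • x) := rfl

theorem tensorAct_one : M.tensorAct V V (LinearMap.id ⊗ₜ 1) = LinearMap.id := by
  ext v x
  simp [tensorAct_tmul]

theorem tensorAct_comp (s : (U →ₗ[k] V) ⊗[k] A) (t : (V →ₗ[k] W) ⊗[k] A) :
    M.tensorAct U W (homTensorComp k A U V W s t) = M.tensorAct V W t ∘ₗ M.tensorAct U V s := by
  induction s with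
  | zero => simp
  | add s s' h h' => simp only [map_add, LinearMap.add_apply, h, h', LinearMap.comp_add]
  | tmul f a =>
    induction t with
    | zero => simp
    | add t t' h h' => simp only [map_add, h, h', LinearMap.add_comp]
    | tmul g b =>
      ext v x
      simp [homTensorComp_tmul, tensorAct_tmul, mul_smul, smul_comm a b x]

theorem tensorAct_mem [Module.Finite k V] [Module.Finite k W] {n : ℤ} {t : (V →ₗ[k] W) ⊗[k] A}
    (ht : t ∈ homTensorDeg k 𝒜 V W n) :
    M.tensorAct V W t ∈ GrVec.homDeg (GrVec.tensor V M.toGrVec) (GrVec.tensor W M.toGrVec) n := by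
  have hle : homTensorDeg k 𝒜 V W n ≤ (GrVec.homDeg (GrVec.tensor V M.toGrVec)
      (GrVec.tensor W M.toGrVec) n).comap (M.tensorAct V W) := by
    refine Submodule.span_le.2 ?_
    rintro _ ⟨f, a, ha, rfl⟩
    refine GrVec.mem_homDeg_tensor fun v m x hx => ?_
    have hax := M.smul_mem ha hx
    rw [add_comm] at hax
    exact GrVec.tmul_mem_tensor (f v) hax
  exact hle ht

end Action

theorem lTensor_mem_homDeg {M N : GrMod k 𝒜} (V : Type u) [AddCommGroup V] [Module k V]
    [Module.Finite k V] {n : ℤ} {φ : M.carrier →ₗ[A] N.carrier} (h : φ ∈ homDeg M N n) :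
    (φ.restrictScalars k).lTensor V ∈
      GrVec.homDeg (GrVec.tensor V M.toGrVec) (GrVec.tensor V N.toGrVec) n :=
  GrVec.mem_homDeg_tensor fun v m x hx => GrVec.tmul_mem_tensor v (h m x hx)

theorem tensorAct_naturality {M N : GrMod k 𝒜} (φ : M.carrier →ₗ[A] N.carrier) {V W : Type u}
    [AddCommGroup V] [Module k V] [AddCommGroup W] [Module k W] (t : (V →ₗ[k] W) ⊗[k] A) :
    (φ.restrictScalars k).lTensor W ∘ₗ M.tensorAct V W t =
      N.tensorAct V W t ∘ₗ (φ.restrictScalars k).lTensor V := by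
  induction t with
  | zero => simp
  | add s s' h h' => simp only [map_add, h, h', LinearMap.add_comp, LinearMap.comp_add]
  | tmul f a =>
    ext v x
    simp [tensorAct_tmul]

variable [GradedAlgebra 𝒜]

/-- The functor `V ⊗ A ↦ V ⊗ M` on `Γ¹ 𝒱_A` attached to a graded `A`-module `M`. -/
noncomputable def tensorFunctor (M : GrMod k 𝒜) : DivPowCat k 𝒜 1 ⥤ GrVec k where
  obj V := GrVec.tensor V.carrier M.toGrVec
  map {V W} f := ⟨M.tensorAct V.carrier W.carrier ((DivPowCat.homEquiv V W).symm f),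
    GrLin.map_mem_iSup (M.tensorAct V.carrier W.carrier) (fun _ _ h => M.tensorAct_mem h) <| by
      rw [(homTensorDeg_isInternal 𝒜
        (DirectSum.Decomposition.isInternal 𝒜)).submodule_iSup_eq_top]
      exact Submodule.mem_top⟩
  map_id V := Subtype.ext <| by
    rw [DivPowCat.homEquiv_symm_one]
    exact M.tensorAct_one
  map_comp f g := Subtype.ext <| by
    rw [DivPowCat.homEquiv_symm_comp]
    exact M.tensorAct_comp _ _

theorem tensorFunctor_map_homEquiv (M : GrMod k 𝒜) {V W : DivPowCat k 𝒜 1}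
    (t : (V.carrier →ₗ[k] W.carrier) ⊗[k] A) :
    (M.tensorFunctor.map (DivPowCat.homEquiv V W t)).1 = M.tensorAct V.carrier W.carrier t :=
  congrArg (M.tensorAct V.carrier W.carrier) (LinearEquiv.symm_apply_apply _ t)

/-- The functor `V ⊗ A ↦ V ⊗ M` as an object of the category of affine functors of degree `1`. -/
noncomputable def toGradedFunctor (M : GrMod k 𝒜) :
    GradedFunctor k (DivPowCat k 𝒜 1) (GrVec k) where
  functor := M.tensorFunctor
  isGraded :=
    { map_add := fun {V W} f g => Subtype.ext <|
        congrArg (M.tensorAct V.carrier W.carrier)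
          (map_add (DivPowCat.homEquiv V W).symm f g) |>.trans (map_add _ _ _)
      map_smul := fun {V W} r f => Subtype.ext <|
        congrArg (M.tensorAct V.carrier W.carrier)
          (map_smul (DivPowCat.homEquiv V W).symm r f) |>.trans (map_smul _ _ _)
      map_mem := fun hf => M.tensorAct_mem (DivPowCat.homEquiv_symm_mem hf) }

/-- The natural transformation `V ⊗ M ⟶ V ⊗ N` induced by a morphism `M ⟶ N`, as a linear function
of the latter. -/
noncomputable def tensorTrans (M N : GrMod k 𝒜) :
    (M ⟶ N) →ₗ[k] (M.tensorFunctor ⟶ N.tensorFunctor) where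
  toFun φ :=
    { app := fun V => ⟨(φ.1.restrictScalars k).lTensor V.carrier,
        GrLin.map_mem_iSup (D := homDeg M N) (LinearMap.lTensorHom V.carrier ∘ₗ
            (LinearMap.restrictScalarsₗ k A M.carrier N.carrier k))
          (fun _ _ h => lTensor_mem_homDeg V.carrier h) φ.2⟩
      naturality := fun V W f => Subtype.ext (tensorAct_naturality φ.1 _) }
  map_add' φ ψ := by
    ext V
    exact Subtype.ext (LinearMap.lTensor_add V.carrier (φ.1.restrictScalars k)
      (ψ.1.restrictScalars k))
  map_smul' r φ := by
    ext V
    exact Subtype.ext (LinearMap.lTensor_smul V.carrier r (φ.1.restrictScalars k))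

theorem tensorTrans_mem {M N : GrMod k 𝒜} {n : ℤ} {φ : M ⟶ N}
    (h : φ ∈ GradedLinear.deg (k := k) M N n) :
    tensorTrans M N φ ∈ GradedFunctor.transDeg M.toGradedFunctor N.toGradedFunctor n :=
  fun V => lTensor_mem_homDeg V.carrier h

variable (k 𝒜) in
/-- The functor from graded `A`-modules to affine functors of degree `1`. -/
noncomputable def toAffine : GrMod k 𝒜 ⥤ GradedFunctor k (DivPowCat k 𝒜 1) (GrVec k) where
  obj M := M.toGradedFunctor
  map {M N} φ := ⟨tensorTrans M N φ, GrLin.map_mem_iSup (tensorTrans M N)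
    (fun _ _ h => tensorTrans_mem h) <| by
      rw [(GradedLinear.isInternal (k := k) M N).submodule_iSup_eq_top]
      exact Submodule.mem_top⟩
  map_id M := Subtype.ext <| by
    ext V
    exact Subtype.ext (LinearMap.lTensor_id V.carrier M.carrier)
  map_comp {M N P} φ ψ := Subtype.ext <| by
    ext V
    exact Subtype.ext (LinearMap.lTensor_comp V.carrier (ψ.1.restrictScalars k)
      (φ.1.restrictScalars k))

theorem toAffine_graded : IsGradedFunctor k (toAffine k 𝒜) where
  map_add {M N} φ ψ := Subtype.ext (map_add (tensorTrans M N) φ ψ)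
  map_smul {M N} r φ := Subtype.ext (map_smul (tensorTrans M N) r φ)
  map_mem h := tensorTrans_mem h

end GrMod

/-! ### Evaluation at the rank one object -/

namespace GradedFunctor

section Iso

variable {k : Type*} [Field k] {C D : Type*} [Category C] [Preadditive C] [Linear k C]
  [GradedLinear k C] [Category D] [Preadditive D] [Linear k D] [GradedLinear k D]

/-- An isomorphism of underlying functors that has degree `0` in both directions. -/
def isoMk {F G : GradedFunctor k C D} (e : F.functor ≅ G.functor)
    (h : e.hom ∈ transDeg F G 0) (h' : e.inv ∈ transDeg G F 0) : F ≅ G where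
  hom := ⟨e.hom, Submodule.mem_iSup_of_mem 0 h⟩
  inv := ⟨e.inv, Submodule.mem_iSup_of_mem 0 h'⟩
  hom_inv_id := Subtype.ext e.hom_inv_id
  inv_hom_id := Subtype.ext e.inv_hom_id

end Iso

open DividedPower DivPowCat

variable {k : Type u} [Field k] {A : Type u} [CommRing A] [Algebra k A] {𝒜 : ℤ → Submodule k A}
  [GradedAlgebra 𝒜]

section

variable (F : GradedFunctor k (DivPowCat k 𝒜 1) (GrVec k)) {U V W : DivPowCat k 𝒜 1}

/-- The action of `Hom(V, W) ⊗ A` on the values of an affine functor of degree `1`. -/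
noncomputable def act (V W : DivPowCat k 𝒜 1) :
    ((V.carrier →ₗ[k] W.carrier) ⊗[k] A) →ₗ[k]
      ((F.functor.obj V).carrier →ₗ[k] (F.functor.obj W).carrier) where
  toFun t := (F.functor.map (homEquiv V W t)).1
  map_add' s t := by
    rw [map_add, F.isGraded.map_add]
    rfl
  map_smul' r t := by
    rw [map_smul, F.isGraded.map_smul]
    rfl

theorem act_one : F.act V V (LinearMap.id ⊗ₜ 1) = LinearMap.id := by
  change (F.functor.map (homEquiv V V (LinearMap.id ⊗ₜ 1))).1 = _
  rw [homEquiv_one, F.functor.map_id]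
  rfl

theorem act_act (f : U.carrier →ₗ[k] V.carrier) (g : V.carrier →ₗ[k] W.carrier) (a b : A)
    (x : (F.functor.obj U).carrier) :
    F.act V W (g ⊗ₜ b) (F.act U V (f ⊗ₜ a) x) = F.act U W ((g ∘ₗ f) ⊗ₜ (a * b)) x := by
  change _ = (F.functor.map (homEquiv U W ((g ∘ₗ f) ⊗ₜ (a * b)))).1 x
  rw [← homEquiv_tmul_comp, F.functor.map_comp]
  rfl

theorem act_mem {n : ℤ} (f : V.carrier →ₗ[k] W.carrier) {a : A} (ha : a ∈ 𝒜 n) :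
    F.act V W (f ⊗ₜ a) ∈ GrVec.homDeg (F.functor.obj V) (F.functor.obj W) n :=
  F.isGraded.map_mem (homEquiv_tmul_mem f ha)

theorem act_mem_zero (f : V.carrier →ₗ[k] W.carrier) :
    F.act V W (f ⊗ₜ 1) ∈ GrVec.homDeg (F.functor.obj V) (F.functor.obj W) 0 :=
  F.act_mem f (SetLike.one_mem_graded 𝒜)

/-- Naturality of a transformation of affine functors, in terms of the actions. -/
theorem app_act {F G : GradedFunctor k (DivPowCat k 𝒜 1) (GrVec k)} (η : F.functor ⟶ G.functor)
    (t : (V.carrier →ₗ[k] W.carrier) ⊗[k] A) (x : (F.functor.obj V).carrier) :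
    (η.app W).1 (F.act V W t x) = G.act V W t ((η.app V).1 x) :=
  LinearMap.congr_fun (congrArg Subtype.val (η.naturality (homEquiv V W t))) x

end

variable (𝒜) in
/-- The object `k ⊗ A` of `Γ¹ 𝒱_A`. -/
abbrev unitObj : DivPowCat k 𝒜 1 where
  carrier := k

/-- The value of an affine functor of degree `1` at `k ⊗ A`, a graded module over
`A = End(k ⊗ A)`. -/
noncomputable def eval (F : GradedFunctor k (DivPowCat k 𝒜 1) (GrVec k)) : GrMod k 𝒜 where
  toGrVec := F.functor.obj (unitObj 𝒜)
  moduleA :=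
    { smul := fun a x => F.act (unitObj 𝒜) (unitObj 𝒜) (LinearMap.id ⊗ₜ a) x
      one_smul := fun x => LinearMap.congr_fun F.act_one x
      mul_smul := fun a b x => by
        -- Functoriality reverses the order of `a` and `b`, so commutativity of `A` is needed.
        change F.act _ _ (LinearMap.id ⊗ₜ (a * b)) x =
          F.act _ _ (LinearMap.id ⊗ₜ a) (F.act _ _ (LinearMap.id ⊗ₜ b) x)
        rw [act_act, mul_comm a b]
        rfl
      smul_zero := fun a => map_zero _
      smul_add := fun a => map_add _
      add_smul := fun a b x => by
        change F.act _ _ (LinearMap.id ⊗ₜ (a + b)) x = F.act _ _ (LinearMap.id ⊗ₜ a) x +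
          F.act _ _ (LinearMap.id ⊗ₜ b) x
        rw [TensorProduct.tmul_add, map_add, LinearMap.add_apply]
      zero_smul := fun x => by
        change F.act _ _ (LinearMap.id ⊗ₜ 0) x = 0
        rw [TensorProduct.tmul_zero, map_zero, LinearMap.zero_apply] }
  tower := by
    refine @IsScalarTower.mk _ _ _ _ (_) (_) fun r a x => ?_
    change F.act _ _ (LinearMap.id ⊗ₜ (r • a)) x = r • F.act _ _ (LinearMap.id ⊗ₜ a) x
    rw [TensorProduct.tmul_smul, map_smul, LinearMap.smul_apply]
  smul_mem {a m r x} hr hx := by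
    have h := F.act_mem (V := unitObj 𝒜) (W := unitObj 𝒜) LinearMap.id hr m x hx
    rw [add_comm] at h
    exact h

/-- The value at `k ⊗ A` of a natural transformation; naturality for `id ⊗ a` makes it
`A`-linear. -/
def evalTrans (F G : GradedFunctor k (DivPowCat k 𝒜 1) (GrVec k)) :
    (F.functor ⟶ G.functor) →ₗ[k] (F.eval.carrier →ₗ[A] G.eval.carrier) where
  toFun η :=
    { toFun := (η.app (unitObj 𝒜)).1
      map_add' := map_add _
      map_smul' := fun a x => app_act η (LinearMap.id ⊗ₜ a) x }
  map_add' _ _ := rfl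
  map_smul' _ _ := rfl

theorem evalTrans_mem {F G : GradedFunctor k (DivPowCat k 𝒜 1) (GrVec k)} {n : ℤ}
    {η : F.functor ⟶ G.functor} (h : η ∈ transDeg F G n) :
    evalTrans F G η ∈ GrMod.homDeg F.eval G.eval n :=
  h (unitObj 𝒜)

variable (k 𝒜) in
/-- Evaluation of affine functors of degree `1` at `k ⊗ A`. -/
noncomputable def evaluation : GradedFunctor k (DivPowCat k 𝒜 1) (GrVec k) ⥤ GrMod k 𝒜 where
  obj F := F.eval
  map {F G} η := ⟨evalTrans F G η.1, GrLin.map_mem_iSup (evalTrans F G)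
    (fun _ _ h => evalTrans_mem h) η.2⟩
  map_id _ := rfl
  map_comp _ _ := rfl

theorem evaluation_graded : IsGradedFunctor k (evaluation k 𝒜) where
  map_add _ _ := rfl
  map_smul _ _ := rfl
  map_mem h := evalTrans_mem h

/-! ### Recovering a functor from its value at the rank one object -/

section Comparison

variable (F : GradedFunctor k (DivPowCat k 𝒜 1) (GrVec k)) (V : DivPowCat k 𝒜 1)

/-- The comparison map `V ⊗ F(k) → F(V)`, `v ⊗ x ↦ F(1 ↦ v)(x)`. -/
noncomputable def assemble :
    V.carrier ⊗[k] (F.functor.obj (unitObj 𝒜)).carrier →ₗ[k] (F.functor.obj V).carrier :=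
  TensorProduct.lift (F.act (unitObj 𝒜) V ∘ₗ
    (TensorProduct.mk k (k →ₗ[k] V.carrier) A).flip 1 ∘ₗ
      (LinearMap.ringLmapEquivSelf k k V.carrier).symm.toLinearMap)

theorem assemble_tmul (v : V.carrier) (x : (F.functor.obj (unitObj 𝒜)).carrier) :
    F.assemble V (v ⊗ₜ x) =
      F.act (unitObj 𝒜) V (LinearMap.toSpanSingleton k V.carrier v ⊗ₜ 1) x :=
  rfl

/-- The inverse `x ↦ ∑ e_j ⊗ F(e_j^*)(x)` of the comparison map, for a basis `e` of `V`. -/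
noncomputable def disassemble :
    (F.functor.obj V).carrier →ₗ[k] V.carrier ⊗[k] (F.functor.obj (unitObj 𝒜)).carrier :=
  ∑ j, TensorProduct.mk k V.carrier (F.functor.obj (unitObj 𝒜)).carrier
      (Module.finBasis k V.carrier j) ∘ₗ
    F.act V (unitObj 𝒜) ((Module.finBasis k V.carrier).coord j ⊗ₜ 1)

theorem disassemble_apply (x : (F.functor.obj V).carrier) :
    F.disassemble V x = ∑ j, Module.finBasis k V.carrier j ⊗ₜ[k]
      (F.act V (unitObj 𝒜) ((Module.finBasis k V.carrier).coord j ⊗ₜ 1) x :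
        (F.functor.obj (unitObj 𝒜)).carrier) := by
  rw [disassemble, LinearMap.sum_apply]
  rfl

theorem assemble_mem :
    F.assemble V ∈ GrVec.homDeg (GrVec.tensor V.carrier (F.functor.obj (unitObj 𝒜)))
      (F.functor.obj V) 0 :=
  GrVec.mem_homDeg_tensor fun v m x hx =>
    F.act_mem_zero (V := unitObj 𝒜) (LinearMap.toSpanSingleton k V.carrier v) m x hx

theorem disassemble_mem :
    F.disassemble V ∈ GrVec.homDeg (F.functor.obj V)
      (GrVec.tensor V.carrier (F.functor.obj (unitObj 𝒜))) 0 := by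
  intro m x hx
  rw [disassemble_apply]
  exact sum_mem fun j _ => GrVec.tmul_mem_tensor _
    (F.act_mem_zero (W := unitObj 𝒜) ((Module.finBasis k V.carrier).coord j) m x hx)

theorem assemble_disassemble : F.assemble V ∘ₗ F.disassemble V = LinearMap.id := by
  ext x
  rw [LinearMap.comp_apply, disassemble_apply, map_sum]
  have hj : ∀ j, F.assemble V (Module.finBasis k V.carrier j ⊗ₜ[k]
      F.act V (unitObj 𝒜) ((Module.finBasis k V.carrier).coord j ⊗ₜ 1) x) =
      F.act V V ((LinearMap.toSpanSingleton k V.carrier (Module.finBasis k V.carrier j) ∘ₗ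
        (Module.finBasis k V.carrier).coord j) ⊗ₜ 1) x := fun j =>
    (F.act_act _ _ _ _ x).trans (by rw [mul_one]; rfl)
  simp only [hj]
  rw [← LinearMap.sum_apply, ← map_sum, ← TensorProduct.sum_tmul]
  have h : ∑ j, LinearMap.toSpanSingleton k V.carrier (Module.finBasis k V.carrier j) ∘ₗ
      (Module.finBasis k V.carrier).coord j = LinearMap.id := by
    ext v
    rw [LinearMap.sum_apply]
    exact (Module.finBasis k V.carrier).sum_repr v
  exact (congrArg (fun f => F.act V V (f ⊗ₜ 1) x) h).trans (LinearMap.congr_fun F.act_one x)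

theorem disassemble_assemble : F.disassemble V ∘ₗ F.assemble V = LinearMap.id := by
  ext v x
  change F.disassemble V (F.assemble V (v ⊗ₜ x)) = v ⊗ₜ x
  rw [disassemble_apply]
  have h : ∀ j, (F.act V (unitObj 𝒜) ((Module.finBasis k V.carrier).coord j ⊗ₜ 1)
      (F.assemble V (v ⊗ₜ x)) : (F.functor.obj (unitObj 𝒜)).carrier) =
        (Module.finBasis k V.carrier).repr v j • x := by
    intro j
    have h' : (Module.finBasis k V.carrier).coord j ∘ₗ LinearMap.toSpanSingleton k V.carrier v =
        (Module.finBasis k V.carrier).repr v j • (LinearMap.id : k →ₗ[k] k) := by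
      ext
      simp
    rw [assemble_tmul, act_act, mul_one]
    refine (congrArg (fun f => F.act (unitObj 𝒜) (unitObj 𝒜) (f ⊗ₜ 1) x) h').trans ?_
    change F.act (unitObj 𝒜) (unitObj 𝒜)
      (((Module.finBasis k V.carrier).repr v j • LinearMap.id) ⊗ₜ 1) x = _
    rw [← TensorProduct.smul_tmul', map_smul, LinearMap.smul_apply]
    exact congrArg _ (LinearMap.congr_fun F.act_one x)
  simp only [h, ← TensorProduct.smul_tmul]
  rw [← TensorProduct.sum_tmul, (Module.finBasis k V.carrier).sum_repr]

variable {V} in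
theorem assemble_naturality {W : DivPowCat k 𝒜 1} (t : (V.carrier →ₗ[k] W.carrier) ⊗[k] A) :
    F.assemble W ∘ₗ F.eval.tensorAct V.carrier W.carrier t = F.act V W t ∘ₗ F.assemble V := by
  induction t with
  | zero =>
    rw [map_zero, map_zero, LinearMap.zero_comp]
    exact LinearMap.comp_zero (F.assemble W)
  | add s t hs ht =>
    rw [map_add, map_add, LinearMap.add_comp, ← hs, ← ht]
    exact LinearMap.comp_add _ _ (F.assemble W)
  | tmul f a =>
    ext v x
    change F.act (unitObj 𝒜) W (LinearMap.toSpanSingleton k W.carrier (f v) ⊗ₜ 1)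
        (F.act (unitObj 𝒜) (unitObj 𝒜) (LinearMap.id ⊗ₜ a) x) =
      F.act V W (f ⊗ₜ a) (F.act (unitObj 𝒜) V (LinearMap.toSpanSingleton k V.carrier v ⊗ₜ 1) x)
    refine (F.act_act _ _ _ _ x).trans (Eq.trans ?_ (F.act_act _ _ _ _ x).symm)
    rw [mul_one, one_mul]
    congr 3
    ext
    simp

theorem assemble_unitObj :
    F.assemble (unitObj 𝒜) =
      (TensorProduct.lid k (F.functor.obj (unitObj 𝒜)).carrier).toLinearMap := by
  ext x
  change F.act (unitObj 𝒜) (unitObj 𝒜) (LinearMap.toSpanSingleton k k 1 ⊗ₜ 1) x = (1 : k) • x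
  rw [show LinearMap.toSpanSingleton k k 1 = LinearMap.id by ext; simp, one_smul]
  exact LinearMap.congr_fun F.act_one x

variable {V} in
theorem assemble_map {W : DivPowCat k 𝒜 1} (f : V ⟶ W) :
    F.assemble W ∘ₗ (F.eval.tensorFunctor.map f).1 = (F.functor.map f).1 ∘ₗ F.assemble V := by
  obtain ⟨t, rfl⟩ := (homEquiv V W).surjective f
  rw [GrMod.tensorFunctor_map_homEquiv]
  exact F.assemble_naturality t

/-- An affine functor `F` of degree `1` is naturally isomorphic to `V ⊗ A ↦ V ⊗ F(k)`. -/
noncomputable def assembleIso : F.eval.toGradedFunctor ≅ F :=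
  isoMk (NatIso.ofComponents
    (fun V => GrVec.isoMk (M := GrVec.tensor V.carrier F.eval.toGrVec) (F.assemble V)
      (F.disassemble V) (F.assemble_mem V) (F.disassemble_mem V) (F.disassemble_assemble V)
      (F.assemble_disassemble V))
    fun f => Subtype.ext (F.assemble_map f)) F.assemble_mem F.disassemble_mem

variable {F} {G : GradedFunctor k (DivPowCat k 𝒜 1) (GrVec k)} in
theorem app_assemble (η : F.functor ⟶ G.functor) :
    G.assemble V ∘ₗ ((evalTrans F G η).restrictScalars k).lTensor V.carrier =
      (η.app V).1 ∘ₗ F.assemble V := by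
  ext v x
  exact (app_act η (LinearMap.toSpanSingleton k V.carrier v ⊗ₜ 1) x).symm

end Comparison

variable (k 𝒜) in
/-- Evaluation followed by tensoring is isomorphic to the identity. -/
noncomputable def assembleNatIso : evaluation k 𝒜 ⋙ GrMod.toAffine k 𝒜 ≅ 𝟭 _ :=
  NatIso.ofComponents (fun F => F.assembleIso) fun {F G} η => Subtype.ext <| by
    ext V
    exact Subtype.ext (app_assemble V η.1)

end GradedFunctor

/-! ### The equivalence -/

namespace GrMod

open DivPowCat GradedFunctor

variable {k : Type u} [Field k] {A : Type u} [CommRing A] [Algebra k A] {𝒜 : ℤ → Submodule k A}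
  [GradedAlgebra 𝒜]

/-- The `A`-linear isomorphism `k ⊗ M ≅ M`. -/
noncomputable def lidA (M : GrMod k 𝒜) : M.toGradedFunctor.eval.carrier ≃ₗ[A] M.carrier where
  __ := TensorProduct.lid k M.carrier
  map_smul' a t := by
    -- The action of `a` on the left is, by definition of `eval`, that of the morphism `id ⊗ a`.
    change TensorProduct.lid k M.carrier (M.tensorAct k k ((homEquiv (unitObj 𝒜) (unitObj 𝒜)).symm
      (homEquiv (unitObj 𝒜) (unitObj 𝒜) (LinearMap.id ⊗ₜ a))) t) =
      a • TensorProduct.lid k M.carrier t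
    rw [LinearEquiv.symm_apply_apply]
    induction (show k ⊗[k] M.carrier from t) with
    | zero => simp
    | add s t hs ht => simp only [map_add, smul_add, hs, ht]
    | tmul c x =>
      change c • a • x = a • c • x
      exact smul_comm c a x

theorem lidA_mem (M : GrMod k 𝒜) :
    M.lidA.toLinearMap ∈ homDeg M.toGradedFunctor.eval M 0 :=
  GrVec.mem_homDeg_tensor (V := k) (M := M.toGrVec) (N := M.toGrVec)
    (f := (TensorProduct.lid k M.carrier).toLinearMap) fun v m x hx => by
      rw [add_zero]
      exact (M.gr m).smul_mem v hx

theorem lidA_symm_mem (M : GrMod k 𝒜) :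
    M.lidA.symm.toLinearMap ∈ homDeg M M.toGradedFunctor.eval 0 := fun m x hx => by
  rw [add_zero]
  exact GrVec.tmul_mem_tensor (V := k) (M := M.toGrVec) 1 hx

/-- A graded module is isomorphic to the evaluation at `k ⊗ A` of its affine functor. -/
noncomputable def evalIso (M : GrMod k 𝒜) : M.toGradedFunctor.eval ≅ M where
  hom := ⟨M.lidA.toLinearMap, Submodule.mem_iSup_of_mem 0 M.lidA_mem⟩
  inv := ⟨M.lidA.symm.toLinearMap, Submodule.mem_iSup_of_mem 0 M.lidA_symm_mem⟩
  hom_inv_id := Subtype.ext (LinearMap.ext M.lidA.symm_apply_apply)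
  inv_hom_id := Subtype.ext (LinearMap.ext M.lidA.apply_symm_apply)

variable (k 𝒜) in
/-- Tensoring followed by evaluation is isomorphic to the identity. -/
noncomputable def evalNatIso : toAffine k 𝒜 ⋙ evaluation k 𝒜 ≅ 𝟭 _ :=
  NatIso.ofComponents evalIso fun {M N} φ => Subtype.ext <| LinearMap.ext fun t => by
    change TensorProduct.lid k N.carrier ((φ.1.restrictScalars k).lTensor k t) =
      φ.1 (TensorProduct.lid k M.carrier t)
    induction (show k ⊗[k] M.carrier from t) with
    | zero => simp
    | add s t hs ht => simp only [map_add, hs, ht]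
    | tmul c x => exact ((φ.1.restrictScalars k).map_smul c x).symm

variable (k 𝒜) in
/-- Affine functors of degree `1` are the same as graded modules, for any graded algebra. -/
noncomputable def affineEquivalence :
    GradedEquivalence k (GradedFunctor k (DivPowCat k 𝒜 1) (GrVec k)) (GrMod k 𝒜) where
  equivalence :=
    { functor := evaluation k 𝒜
      inverse := toAffine k 𝒜
      unitIso := (assembleNatIso k 𝒜).symm
      counitIso := evalNatIso k 𝒜
      functor_unitIso_comp := fun F => Subtype.ext <| LinearMap.ext fun x => by
        -- Under `V = k` the comparison map is `k ⊗ F(k) = F(k)`, the counit; the unit inverts it.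
        change (TensorProduct.lid k (F.functor.obj (unitObj 𝒜)).carrier).toLinearMap
          (F.disassemble (unitObj 𝒜) x) = x
        rw [← F.assemble_unitObj]
        exact LinearMap.congr_fun (F.assemble_disassemble (unitObj 𝒜)) x }
  functor_graded := evaluation_graded
  inverse_graded := toAffine_graded
  unit_mem F := F.disassemble_mem
  counit_mem M := M.lidA_mem

end GrMod

theorem corollary5p6 (k : Type u) [Field k] (p : ℕ) [Fact p.Prime] [CharP k p] (i : ℕ)
    (w : Fin i → ℤ)
    (hw : (∀ j : Fin i, w j = 2 * (p : ℤ) ^ (j : ℕ)) ∨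
      (∀ j : Fin i, w j = 2 * (p : ℤ) ^ ((j : ℕ) + 1))) :
    Nonempty (GradedEquivalence k (AffineFunctor k p w 1)
      (GrMod k (TruncPoly.grading k p w))) :=
  ⟨GrMod.affineEquivalence k (TruncPoly.grading k p w)⟩
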